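/- Let $k$ be an arbitrary field, let $n\ge 0$, and let $I\subseteq k[x_0,\dots,x_n]$ be a homogeneous ideal. Let $d=\dim I$ be the dimension of the projective variety defined by $I$, that is, the Krull dimension of $k[x_0,\dots,x_n]/I$ minus $1$, with $d=-1$ if this variety is empty (in particular for the unit ideal). Assume $d\le n-1$, i.e. $I\neq 0$. Let $h_I(m)=\dim_k (k[x_0,\dots,x_n]/I)_m$ be the Hilbert function of $I$. If $d\ge 0$, let $\deg I=d!\,a_d$, where $a_d$ is the coefficient of $t^d$ in the Hilbert polynomial of $I$; if $d=-1$, let $\deg I=\dim_k k[x_0,\dots,x_n]/I$ (so the unit ideal has degree $0$). A binomial coefficient $\binom{a}{b}$ with $a<0$ is understood to be $0$. Then $$h_I(m)=\binom{m+d+1}{d+1}-\binom{m-\deg I+d+1}{d+1}\qquad\text{for all integers } m\ge 1$$ if and only if there exist linearly independent linear forms $u_1,\dots,u_{n-d-1}\in k[x_0,\dots,x_n]$ and a polynomial $f\notin (u_1,\dots,u_{n-d-1})$ such that $I=(u_1,\dots,u_{n-d-1},f)$. -/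

import Mathlib

attribute [local instance] MvPolynomial.gradedAlgebra

namespace ProjIdeal

noncomputable section

/-- The Hilbert function `h_I(m) = dim_k (k[x_0, …, x_n]/I)_m` for `m ≥ 0` (it vanishes for `m < 0`).
For a homogeneous ideal `I`, the degree `m` part of the quotient is the image of the space of
forms of degree `m`. -/
def hilbertFunction {k : Type*} [Field k] {n : ℕ}
    (I : Ideal (MvPolynomial (Fin (n + 1)) k)) (m : ℕ) : ℕ :=
  Module.finrank k
    ((MvPolynomial.homogeneousSubmodule (Fin (n + 1)) k m).map
      (Ideal.Quotient.mkₐ k I).toLinearMap)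

/-- The dimension of a homogeneous ideal, that is, of the projective variety that it defines: the
Krull dimension of the quotient ring minus one. It is `-1` when the variety is empty, which
includes the unit ideal (the Krull dimension `⊥` of the zero ring is read as `0`). The Krull
dimension of a quotient of `k[x_0, …, x_n]` is at most `n + 1`, so it is never `⊤`. -/
def dimension {k : Type*} [Field k] {n : ℕ}
    (I : Ideal (MvPolynomial (Fin (n + 1)) k)) : ℤ :=
  (((ringKrullDim (MvPolynomial (Fin (n + 1)) k ⧸ I)).unbotD 0).toNat : ℤ) - 1

/-- `p` agrees with the Hilbert function of `I` at all large integers. There is at most one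
such `p`, and there is one for every homogeneous `I`. -/
def IsHilbertPolynomial {k : Type*} [Field k] {n : ℕ}
    (I : Ideal (MvPolynomial (Fin (n + 1)) k)) (p : Polynomial ℚ) : Prop :=
  ∀ᶠ m : ℕ in Filter.atTop, (hilbertFunction I m : ℚ) = p.eval (m : ℚ)

open Classical in
/-- The Hilbert polynomial of a homogeneous ideal. -/
def hilbertPolynomial {k : Type*} [Field k] {n : ℕ}
    (I : Ideal (MvPolynomial (Fin (n + 1)) k)) : Polynomial ℚ :=
  if h : ∃ p, IsHilbertPolynomial I p then h.choose else 0

/-- The degree of a homogeneous ideal of dimension `d`. For `d ≥ 0` it is `d!` times the coefficient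
of `t ^ d` in the Hilbert polynomial; this rational number is a natural number, and the floor
only changes its type. For `d = -1` it is the dimension over `k` of the quotient ring (in
particular `0` for the unit ideal). -/
def degree {k : Type*} [Field k] {n : ℕ}
    (I : Ideal (MvPolynomial (Fin (n + 1)) k)) : ℕ :=
  if dimension I = -1 then
    Module.finrank k (MvPolynomial (Fin (n + 1)) k ⧸ I)
  else
    ⌊((dimension I).toNat.factorial : ℚ) * (hilbertPolynomial I).coeff (dimension I).toNat⌋₊

/-- The binomial coefficient of integers `a` over `b`, with the convention that it is `0` when `a`
or `b` is negative (and when `b > a`). -/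
def binom (a b : ℤ) : ℤ :=
  if 0 ≤ a ∧ 0 ≤ b then (a.toNat.choose b.toNat : ℤ) else 0

end

end ProjIdeal

/-! Put `r = d + 1` and `c = n - r`. The formula says that `I` has the Hilbert function of a form of
degree `e = degree I` in `r + 1` variables. Modulo `c` independent linear forms the ring is a
polynomial ring in `r + 1` variables (`exists_algHom_ker_eq_span`), and pulling ideals back along
this graded surjection `φ` keeps Hilbert functions (`hilbertFunction_comap`).

From the formula, the value at `m = 1` puts `c` independent linear forms in `I`. The image of `I`
under `φ` then contains a nonzero form `g` of degree `e`, and equality of Hilbert functions forces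
it to be `(g)`. Conversely, if `I = (u, f)`, then `φ f` is a form, `I` is the preimage of `(φ f)`,
and `degree I` is the degree of `φ f`, whether it is read off the Hilbert polynomial or, for `d =
-1`, off the length of the quotient. -/

/-! ### Forms, linear substitutions and principal ideals. -/

open MvPolynomial in
theorem MvPolynomial.finrank_homogeneousSubmodule (k : Type*) [Field k] (r m : ℕ) :
    Module.finrank k (homogeneousSubmodule (Fin (r + 1)) k m) = (m + r).choose r := by
  classical
  have h : homogeneousSubmodule (Fin (r + 1)) k m =
      restrictSupport k {d : Fin (r + 1) →₀ ℕ | d.degree = m} :=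
    homogeneousSubmodule_eq_finsupp_supported (Fin (r + 1)) k m
  have hset : {d : Fin (r + 1) →₀ ℕ | d.degree = m} =
      ↑(Finset.finsuppAntidiag (Finset.univ : Finset (Fin (r + 1))) m) := by
    ext d
    simp [Finset.mem_finsuppAntidiag, Finsupp.degree_eq_sum]
  rw [h, Module.finrank_eq_nat_card_basis (basisRestrictSupport k _), hset,
    Nat.card_coe_set_eq, Set.ncard_coe_finset, Finset.card_finsuppAntidiag_nat_eq_choose]
  · simp only [Finset.card_univ, Fintype.card_fin]
    rw [show r + 1 + m - 1 = m + r by omega, ← Nat.choose_symm_add]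

instance MvPolynomial.finite_homogeneousSubmodule (k : Type*) [Field k] (σ : Type*) [Finite σ] (m : ℕ) :
    Module.Finite k (homogeneousSubmodule σ k m) :=
  Module.Finite.of_fg (homogeneousSubmodule_fg σ k m)

/-- Rank–nullity for the image of a finite-dimensional subspace. -/
theorem Submodule.finrank_map_add_finrank_inf_ker {k V W : Type*} [Field k] [AddCommGroup V]
    [Module k V] [AddCommGroup W] [Module k W] (f : V →ₗ[k] W) (p : Submodule k V)
    [Module.Finite k p] :
    Module.finrank k (p.map f) + Module.finrank k (p ⊓ LinearMap.ker f : Submodule k V) =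
      Module.finrank k p := by
  have h := LinearMap.finrank_range_add_finrank_ker (f.domRestrict p)
  rw [LinearMap.range_domRestrict, LinearMap.ker_domRestrict] at h
  rw [← h, ← LinearEquiv.finrank_eq (Submodule.comapSubtypeEquivOfLe
    (inf_le_left : p ⊓ LinearMap.ker f ≤ p)), Submodule.comap_inf, Submodule.comap_subtype_self,
    top_inf_eq]

open MvPolynomial in
/-- Modulo independent linear forms, a polynomial ring is a polynomial ring in fewer variables. -/
theorem MvPolynomial.exists_algHom_ker_eq_span {k : Type*} [Field k] {N c s : ℕ} (hN : N = c + s)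
    (u : Fin c → MvPolynomial (Fin N) k) (hu : ∀ i, (u i).IsHomogeneous 1)
    (hli : LinearIndependent k u) :
    ∃ (φ : MvPolynomial (Fin N) k →ₐ[k] MvPolynomial (Fin s) k)
      (ψ : MvPolynomial (Fin s) k →ₐ[k] MvPolynomial (Fin N) k),
      RingHom.ker φ = Ideal.span (Set.range u) ∧ (∀ p, φ (ψ p) = p) ∧
      (∀ i, (φ (X i)).IsHomogeneous 1) ∧ (∀ j, (ψ (X j)).IsHomogeneous 1) := by
  classical
  let L (t : ℕ) : (Fin t → k) →ₗ[k] MvPolynomial (Fin t) k := Fintype.linearCombination k X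
  have hL (t : ℕ) (v : Fin t → k) : (L t v).IsHomogeneous 1 := by
    simp only [L, Fintype.linearCombination_apply]
    refine IsHomogeneous.sum _ _ _ fun i _ => ?_
    rw [smul_eq_C_mul]
    exact isHomogeneous_C_mul_X _ _
  have hLX (t : ℕ) (i : Fin t) : L t (Pi.single i 1) = X i := by
    simp [L, Fintype.linearCombination_apply_single]
  have hex : ∀ i, ∃ a, L N a = u i := fun i => by
    have h := hu i
    rw [← mem_homogeneousSubmodule, homogeneousSubmodule_one_eq_span_X,
      ← Fintype.range_linearCombination] at h
    exact h
  choose a ha using hex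
  have hali : LinearIndependent k a := by
    refine LinearIndependent.of_comp (L N) ?_
    convert hli using 1
    ext1 i
    exact ha i
  -- `φ` and `ψ` are induced on linear forms by the projection `π` with kernel `W` and a linear
  -- section `σ` of it.
  let W := Submodule.span k (Set.range a)
  have hW : Module.finrank k ((Fin N → k) ⧸ W) = Module.finrank k (Fin s → k) := by
    have h1 := Submodule.finrank_quotient_add_finrank W
    rw [finrank_span_eq_card hali] at h1
    simp only [Module.finrank_fin_fun, Fintype.card_fin] at h1 ⊢
    omega
  let e := LinearEquiv.ofFinrankEq _ _ hW
  let π : (Fin N → k) →ₗ[k] (Fin s → k) := e.toLinearMap ∘ₗ W.mkQ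
  have hπ : Function.Surjective π := e.surjective.comp W.mkQ_surjective
  have hπW : LinearMap.ker π = W := by simp [π, LinearMap.ker_comp]
  obtain ⟨σ, hσ⟩ := π.exists_rightInverse_of_surjective (LinearMap.range_eq_top.2 hπ)
  let φ : MvPolynomial (Fin N) k →ₐ[k] MvPolynomial (Fin s) k :=
    aeval fun i => L s (π (Pi.single i 1))
  let ψ : MvPolynomial (Fin s) k →ₐ[k] MvPolynomial (Fin N) k :=
    aeval fun i => L N (σ (Pi.single i 1))
  have hφ (v) : φ (L N v) = L s (π v) := by
    have : φ.toLinearMap ∘ₗ L N = L s ∘ₗ π := by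
      refine LinearMap.pi_ext' fun i => LinearMap.ext_ring ?_
      simp [hLX, φ]
    exact LinearMap.congr_fun this v
  have hψ (v) : ψ (L s v) = L N (σ v) := by
    have : ψ.toLinearMap ∘ₗ L s = L N ∘ₗ σ := by
      refine LinearMap.pi_ext' fun i => LinearMap.ext_ring ?_
      simp [hLX, ψ]
    exact LinearMap.congr_fun this v
  have hπσ (v) : π (σ v) = v := LinearMap.congr_fun hσ v
  have hLW (w) (hw : w ∈ W) : L N w ∈ Ideal.span (Set.range u) := by
    induction hw using Submodule.span_induction with
    | mem x hx =>
      obtain ⟨i, rfl⟩ := hx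
      exact Ideal.subset_span ⟨i, (ha i).symm⟩
    | zero => simp
    | add x y _ _ hx hy => simpa using add_mem hx hy
    | smul c x _ hx => simpa [smul_eq_C_mul] using Ideal.mul_mem_left _ _ hx
  refine ⟨φ, ψ, le_antisymm ?_ ?_, fun p => ?_, fun i => ?_, fun i => ?_⟩
  · intro p hp
    -- `ψ ∘ φ` is the identity modulo the `u i`, since `σ (π v) - v` lies in `W`.
    have h : ((Ideal.Quotient.mkₐ k (Ideal.span (Set.range u))).comp ψ).comp φ =
        Ideal.Quotient.mkₐ k (Ideal.span (Set.range u)) := by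
      refine MvPolynomial.algHom_ext fun i => ?_
      rw [← hLX, AlgHom.comp_apply, AlgHom.comp_apply, hφ, hψ]
      refine Ideal.Quotient.eq.2 ?_
      rw [← map_sub]
      refine hLW _ ?_
      rw [← hπW]
      simp [hπσ]
    have h2 := DFunLike.congr_fun h p
    rw [RingHom.mem_ker] at hp
    rw [AlgHom.comp_apply, hp, map_zero] at h2
    exact Ideal.Quotient.eq_zero_iff_mem.1 h2.symm
  · rw [Ideal.span_le]
    rintro _ ⟨i, rfl⟩
    change φ (u i) = 0
    have : π (a i) = 0 := by
      rw [← LinearMap.mem_ker, hπW]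
      exact Submodule.subset_span ⟨i, rfl⟩
    rw [← ha, hφ, this, map_zero]
  · have h : φ.comp ψ = AlgHom.id k _ := by
      refine MvPolynomial.algHom_ext fun i => ?_
      rw [← hLX, AlgHom.comp_apply, hψ, hφ, hπσ, AlgHom.id_apply]
    exact DFunLike.congr_fun h p
  · simpa [φ] using hL s _
  · simpa [ψ] using hL N _

open MvPolynomial in
theorem MvPolynomial.IsHomogeneous.map_algHom {k σ τ : Type*} [Field k]
    {φ : MvPolynomial σ k →ₐ[k] MvPolynomial τ k} (hφ : ∀ i, (φ (X i)).IsHomogeneous 1)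
    {p : MvPolynomial σ k} {m : ℕ} (hp : p.IsHomogeneous m) : (φ p).IsHomogeneous m := by
  have := hp.aeval (fun i => φ (X i)) hφ
  rw [one_mul] at this
  convert this using 1
  exact DFunLike.congr_fun (aeval_unique φ) p

open MvPolynomial in
theorem MvPolynomial.map_homogeneousSubmodule_eq {k σ τ : Type*} [Field k]
    {φ : MvPolynomial σ k →ₐ[k] MvPolynomial τ k} {ψ : MvPolynomial τ k →ₐ[k] MvPolynomial σ k}
    (h : ∀ p, φ (ψ p) = p) (hφ : ∀ i, (φ (X i)).IsHomogeneous 1)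
    (hψ : ∀ i, (ψ (X i)).IsHomogeneous 1) (m : ℕ) :
    (homogeneousSubmodule σ k m).map φ.toLinearMap = homogeneousSubmodule τ k m := by
  refine le_antisymm ?_ fun p hp => ⟨ψ p, IsHomogeneous.map_algHom hψ hp, h p⟩
  rintro _ ⟨p, hp, rfl⟩
  exact IsHomogeneous.map_algHom hφ hp

open MvPolynomial in
theorem MvPolynomial.homogeneousComponent_mul_of_isHomogeneous_left {k σ : Type*} [Field k]
    {e : ℕ} {g : MvPolynomial σ k} (hg : g.IsHomogeneous e) (q : MvPolynomial σ k) (m : ℕ) :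
    homogeneousComponent m (g * q) = if e ≤ m then g * homogeneousComponent (m - e) q else 0 := by
  classical
  have key (p : MvPolynomial σ k) (i : ℕ) :
      homogeneousComponent i p = DirectSum.decompose (homogeneousSubmodule σ k) p i :=
    (decomposition.decompose'_apply p i).symm
  split_ifs with h
  · rw [key, key, DirectSum.coe_decompose_mul_of_left_mem_of_le _ hg h]
  · rw [key, DirectSum.coe_decompose_mul_of_left_mem_of_not_le _ hg h]

open MvPolynomial in
/-- The forms of degree `m` in the principal ideal of a form of degree `e`. -/
theorem MvPolynomial.finrank_homogeneousSubmodule_inf_span_singleton {k : Type*} [Field k]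
    {r e : ℕ} {g : MvPolynomial (Fin (r + 1)) k} (hg : g.IsHomogeneous e) (hg0 : g ≠ 0) (m : ℕ) :
    Module.finrank k (homogeneousSubmodule (Fin (r + 1)) k m ⊓
      (Ideal.span {g}).restrictScalars k : Submodule k _) =
      if e ≤ m then (m - e + r).choose r else 0 := by
  have hmul {q} (hq : (g * q).IsHomogeneous m) :
      g * q = if e ≤ m then g * homogeneousComponent (m - e) q else 0 := by
    rw [← homogeneousComponent_mul_of_isHomogeneous_left hg, homogeneousComponent_eq_self hq]
  split_ifs with hem
  · simp only [hem, if_true] at hmul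
    have : homogeneousSubmodule (Fin (r + 1)) k m ⊓ (Ideal.span {g}).restrictScalars k =
        (homogeneousSubmodule (Fin (r + 1)) k (m - e)).map (LinearMap.mulLeft k g) := by
      apply le_antisymm
      · rintro p ⟨hp, hpg⟩
        obtain ⟨q, rfl⟩ := Ideal.mem_span_singleton.1 hpg
        exact ⟨homogeneousComponent (m - e) q, homogeneousComponent_mem _ _, (hmul hp).symm⟩
      · rintro _ ⟨q, hq, rfl⟩
        refine ⟨?_, Ideal.mul_mem_right _ _ (Ideal.mem_span_singleton_self g)⟩
        have := hg.mul hq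
        rwa [Nat.add_sub_cancel' hem] at this
    rw [this, LinearEquiv.finrank_eq (Submodule.equivMapOfInjective _ _ _).symm,
      finrank_homogeneousSubmodule]
    exact fun a b hab => mul_left_cancel₀ hg0 hab
  · simp only [hem, if_false] at hmul
    rw [Submodule.finrank_eq_zero, eq_bot_iff]
    rintro p ⟨hp, hpg⟩
    obtain ⟨q, rfl⟩ := Ideal.mem_span_singleton.1 hpg
    exact (Submodule.mem_bot k).2 (hmul hp)

open MvPolynomial in
/-- A generator of a principal homogeneous ideal is a form. -/
theorem MvPolynomial.isHomogeneous_totalDegree_of_homogeneousComponent_mem {k σ : Type*} [Field k]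
    {g : MvPolynomial σ k} (h : ∀ i, homogeneousComponent i g ∈ Ideal.span {g}) :
    g.IsHomogeneous g.totalDegree := by
  -- A nonzero multiple of `g` cannot have smaller total degree than `g`.
  have hz : ∀ i, i < g.totalDegree → homogeneousComponent i g = 0 := fun i hi => by
    by_contra hne
    have h1 := totalDegree_le_of_dvd_of_isDomain (Ideal.mem_span_singleton.1 (h i)) hne
    rw [(homogeneousComponent_isHomogeneous i g).totalDegree hne] at h1
    omega
  have h2 := sum_homogeneousComponent g
  rw [Finset.sum_range_succ, Finset.sum_eq_zero fun i hi => hz i (Finset.mem_range.1 hi),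
    zero_add] at h2
  have h3 := homogeneousComponent_isHomogeneous g.totalDegree g
  rwa [h2] at h3

/-! ### Hilbert function, dimension and degree. -/

namespace ProjIdeal

open MvPolynomial

variable {k : Type*} [Field k] {n : ℕ}

theorem hilbertFunction_add_finrank_inf (I : Ideal (MvPolynomial (Fin (n + 1)) k)) (m : ℕ) :
    hilbertFunction I m + Module.finrank k (homogeneousSubmodule (Fin (n + 1)) k m ⊓
      I.restrictScalars k : Submodule k _) = (m + n).choose n := by
  have h := Submodule.finrank_map_add_finrank_inf_ker (Ideal.Quotient.mkₐ k I).toLinearMap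
    (homogeneousSubmodule (Fin (n + 1)) k m)
  rw [finrank_homogeneousSubmodule] at h
  rw [← h, hilbertFunction]
  have hk : LinearMap.ker (Ideal.Quotient.mkₐ k I).toLinearMap = I.restrictScalars k := by
    ext x
    simp [Ideal.Quotient.eq_zero_iff_mem]
  rw [hk]

/-- The Hilbert function is unchanged by a graded surjection of polynomial rings. -/
theorem hilbertFunction_comap {r : ℕ}
    {φ : MvPolynomial (Fin (n + 1)) k →ₐ[k] MvPolynomial (Fin (r + 1)) k}
    (hφ : ∀ m, (homogeneousSubmodule (Fin (n + 1)) k m).map φ.toLinearMap =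
      homogeneousSubmodule (Fin (r + 1)) k m)
    (J : Ideal (MvPolynomial (Fin (r + 1)) k)) (m : ℕ) :
    hilbertFunction (J.comap φ) m = hilbertFunction J m := by
  have h := Submodule.finrank_map_add_finrank_inf_ker
    ((Ideal.Quotient.mkₐ k J).toLinearMap ∘ₗ φ.toLinearMap)
    (homogeneousSubmodule (Fin (n + 1)) k m)
  have hk : LinearMap.ker ((Ideal.Quotient.mkₐ k J).toLinearMap ∘ₗ φ.toLinearMap) =
      (J.comap φ).restrictScalars k := by
    ext x
    simp [Ideal.Quotient.eq_zero_iff_mem]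
  rw [finrank_homogeneousSubmodule, Submodule.map_comp, hφ, hk] at h
  have h2 := hilbertFunction_add_finrank_inf (J.comap φ) m
  rw [← h] at h2
  exact Nat.add_right_cancel h2

theorem hilbertFunction_span_singleton {r e : ℕ} {g : MvPolynomial (Fin (r + 1)) k}
    (hg : g.IsHomogeneous e) (hg0 : g ≠ 0) (m : ℕ) :
    hilbertFunction (Ideal.span {g}) m + (if e ≤ m then (m - e + r).choose r else 0) =
      (m + r).choose r := by
  rw [← hilbertFunction_add_finrank_inf (Ideal.span {g}) m,
    finrank_homogeneousSubmodule_inf_span_singleton hg hg0]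

/-- All variables vanish in the quotient, so only constants survive. -/
theorem algebraMap_quotient_surjective_of_hilbertFunction_one
    {I : Ideal (MvPolynomial (Fin (n + 1)) k)} (h : hilbertFunction I 1 = 0) :
    Function.Surjective (algebraMap k (MvPolynomial (Fin (n + 1)) k ⧸ I)) := by
  have h1 : ∀ i, Ideal.Quotient.mk I (X i) = 0 := fun i => by
    rw [hilbertFunction, Submodule.finrank_eq_zero] at h
    rw [← Submodule.mem_bot k, ← h]
    exact ⟨X i, isHomogeneous_X k i, rfl⟩
  intro q
  obtain ⟨p, rfl⟩ := Ideal.Quotient.mk_surjective q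
  induction p using MvPolynomial.induction_on with
  | C a => exact ⟨a, rfl⟩
  | add p q hp hq =>
    obtain ⟨a, ha⟩ := hp
    obtain ⟨b, hb⟩ := hq
    exact ⟨a + b, by simp [ha, hb]⟩
  | mul_X p i _ => exact ⟨0, by simp [h1]⟩

theorem dimension_eq_neg_one_of_hilbertFunction_one
    {I : Ideal (MvPolynomial (Fin (n + 1)) k)} (h : hilbertFunction I 1 = 0) :
    dimension I = -1 := by
  have h1 := ringKrullDim_le_of_surjective _ (algebraMap_quotient_surjective_of_hilbertFunction_one h)
  rw [ringKrullDim_eq_zero_of_field] at h1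
  have h2 : (ringKrullDim (MvPolynomial (Fin (n + 1)) k ⧸ I)).unbotD 0 ≤ 0 := by
    rw [WithBot.unbotD_le_iff (by simp)]
    exact h1
  simp [dimension, nonpos_iff_eq_zero.1 h2]

/-- Here the dimension is `-1`, so the degree is the length of the quotient. This settles `m = 0`
when the degree is `0`. -/
theorem eq_top_of_degree_eq_zero_of_hilbertFunction_one
    {I : Ideal (MvPolynomial (Fin (n + 1)) k)} (h : hilbertFunction I 1 = 0)
    (hD : degree I = 0) : I = ⊤ := by
  rw [degree, if_pos (dimension_eq_neg_one_of_hilbertFunction_one h)] at hD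
  have : Module.Finite k (MvPolynomial (Fin (n + 1)) k ⧸ I) :=
    Module.Finite.of_surjective (Algebra.linearMap k _)
      (algebraMap_quotient_surjective_of_hilbertFunction_one h)
  exact Ideal.Quotient.subsingleton_iff.1 (Module.finrank_zero_iff.1 hD)

theorem dimension_top : dimension (⊤ : Ideal (MvPolynomial (Fin (n + 1)) k)) = -1 := by
  have : Subsingleton (MvPolynomial (Fin (n + 1)) k ⧸ (⊤ : Ideal (MvPolynomial (Fin (n + 1)) k))) :=
    Ideal.Quotient.subsingleton_iff.2 rfl
  simp [dimension, ringKrullDim_eq_bot_of_subsingleton]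

theorem degree_top : degree (⊤ : Ideal (MvPolynomial (Fin (n + 1)) k)) = 0 := by
  have : Subsingleton (MvPolynomial (Fin (n + 1)) k ⧸ (⊤ : Ideal (MvPolynomial (Fin (n + 1)) k))) :=
    Ideal.Quotient.subsingleton_iff.2 rfl
  rw [degree, if_pos dimension_top, Module.finrank_zero_of_subsingleton]

/-- In one variable a form of degree `e` is a scalar times `x ^ e`. -/
theorem finrank_quotient_span_singleton_of_isHomogeneous {e : ℕ} {g : MvPolynomial (Fin 1) k}
    (hg : g.IsHomogeneous e) (hg0 : g ≠ 0) :
    Module.finrank k (MvPolynomial (Fin 1) k ⧸ Ideal.span {g}) = e := by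
  have hmon : g = monomial (Finsupp.single 0 e) (coeff (Finsupp.single 0 e) g) := by
    ext d
    rw [coeff_monomial]
    split_ifs with h
    · rw [h]
    · refine hg.coeff_eq_zero fun hd => h ?_
      refine Finsupp.ext fun i => ?_
      rw [Subsingleton.elim i 0, ← hd]
      simp [Finsupp.degree_eq_sum]
  let θ := MvPolynomial.uniqueAlgEquiv k (Fin 1)
  have hc : coeff (Finsupp.single 0 e) g ≠ 0 := fun h => hg0 (by rw [hmon, h, monomial_zero])
  have hθ : θ g = Polynomial.C (coeff (Finsupp.single 0 e) g) * Polynomial.X ^ e := by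
    conv_lhs => rw [hmon]
    simp [θ]
  rw [LinearEquiv.finrank_eq (Ideal.quotientEquivAlg (Ideal.span {g}) (Ideal.span {θ g}) θ
    (by simp [Ideal.map_span])).toLinearEquiv, finrank_quotient_span_eq_natDegree, hθ,
    Polynomial.natDegree_C_mul_X_pow _ _ hc]

/-- Iterating Pascal's rule turns the difference of binomials into `e` terms `(m - j + d).choose d`,
each a polynomial in `m` with leading coefficient `1 / d!`. -/
theorem coeff_hilbertPolynomial {I : Ideal (MvPolynomial (Fin (n + 1)) k)} {d e : ℕ}
    (h : ∀ m, hilbertFunction I m + (if e ≤ m then (m - e + (d + 1)).choose (d + 1) else 0) =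
      (m + (d + 1)).choose (d + 1)) :
    (hilbertPolynomial I).coeff d = e * (d.factorial : ℚ)⁻¹ := by
  let p : Polynomial ℚ := ∑ j ∈ Finset.range e, Polynomial.preHilbertPoly ℚ d j
  have hsum (e m : ℕ) (hm : e ≤ m) : (m + (d + 1)).choose (d + 1) =
      (∑ j ∈ Finset.range e, (m - j + d).choose d) + (m - e + (d + 1)).choose (d + 1) := by
    induction e with
    | zero => simp
    | succ e ih =>
      rw [ih (by omega), Finset.sum_range_succ, add_assoc]
      congr 1
      obtain ⟨a, ha⟩ : ∃ a, m - e = a + 1 := ⟨m - e - 1, by omega⟩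
      rw [show m - (e + 1) = a by omega, ha, show a + 1 + (d + 1) = (a + 1 + d) + 1 by ring,
        Nat.choose_succ_succ, show a + 1 + d = a + (d + 1) by ring]
  have hp : IsHilbertPolynomial I p := by
    filter_upwards [Filter.eventually_ge_atTop e] with m hm
    have h1 := h m
    rw [if_pos hm, hsum e m hm] at h1
    rw [Nat.add_right_cancel h1]
    push_cast
    rw [Polynomial.eval_finsetSum]
    refine Finset.sum_congr rfl fun j hj => ?_
    rw [Polynomial.preHilbertPoly_eq_choose_sub_add ℚ _ ((Finset.mem_range.1 hj).le.trans hm)]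
  have hex : ∃ p, IsHilbertPolynomial I p := ⟨p, hp⟩
  have heq : hilbertPolynomial I = p := by
    rw [hilbertPolynomial, dif_pos hex]
    obtain ⟨N, hN⟩ := Filter.eventually_atTop.1 (hex.choose_spec.and hp)
    refine Polynomial.eq_of_infinite_eval_eq _ _
      (((Set.Ici_infinite N).image Nat.cast_injective.injOn).mono ?_)
    rintro _ ⟨m, hm, rfl⟩
    exact (hN m hm).1.symm.trans (hN m hm).2
  rw [heq, Polynomial.finsetSum_coeff]
  simp [Polynomial.coeff_preHilbertPoly_self]

/-- The degree of a hypersurface in a linear subspace. -/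
theorem degree_comap_span_singleton {r e : ℕ}
    {φ : MvPolynomial (Fin (n + 1)) k →ₐ[k] MvPolynomial (Fin (r + 1)) k}
    (hφ : ∀ m, (homogeneousSubmodule (Fin (n + 1)) k m).map φ.toLinearMap =
      homogeneousSubmodule (Fin (r + 1)) k m) (hs : Function.Surjective φ)
    {g : MvPolynomial (Fin (r + 1)) k} (hg : g.IsHomogeneous e) (hg0 : g ≠ 0)
    (hdim : dimension ((Ideal.span {g}).comap φ) = (r : ℤ) - 1) :
    degree ((Ideal.span {g}).comap φ) = e := by
  rw [degree, hdim]
  rcases r with _ | d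
  · rw [if_pos (by simp), ← finrank_quotient_span_singleton_of_isHomogeneous hg hg0]
    have hk : RingHom.ker ((Ideal.Quotient.mkₐ k (Ideal.span {g})).comp φ) =
        (Ideal.span {g}).comap φ := by
      ext x
      simp [RingHom.mem_ker, Ideal.Quotient.eq_zero_iff_mem]
    rw [← hk]
    exact LinearEquiv.finrank_eq (Ideal.quotientKerAlgEquivOfSurjective
      (f := (Ideal.Quotient.mkₐ k (Ideal.span {g})).comp φ)
      ((Ideal.Quotient.mkₐ_surjective k _).comp hs)).toLinearEquiv
  · rw [if_neg (by omega), show (((d + 1 : ℕ) : ℤ) - 1).toNat = d by omega,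
      coeff_hilbertPolynomial (d := d) (e := e) fun m => by
        rw [hilbertFunction_comap hφ, hilbertFunction_span_singleton hg hg0]]
    have : (d.factorial : ℚ) ≠ 0 := by positivity
    rw [mul_left_comm, mul_inv_cancel₀ this, mul_one, Nat.floor_natCast]

theorem binom_add_natCast (m r : ℕ) : binom ((m : ℤ) + r) r = (m + r).choose r := by
  rw [binom, if_pos (by omega)]
  norm_cast

theorem binom_sub_add_natCast (m e r : ℕ) :
    binom ((m : ℤ) - e + r) r = if e ≤ m then ((m - e + r).choose r : ℤ) else 0 := by
  split_ifs with h
  · rw [← binom_add_natCast, Nat.cast_sub h]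
  · rw [binom]
    split_ifs
    -- For `m < e` a nonnegative upper entry is still below `r`, so the binomial vanishes without
    -- the convention.
    · rw [Nat.choose_eq_zero_of_lt (by omega), Nat.cast_zero]
    · rfl

end ProjIdeal

/-! ### Transport along `φ` and the two implications. -/

open MvPolynomial in
theorem MvPolynomial.homogeneousComponent_algHom {k σ τ : Type*} [Field k]
    {φ : MvPolynomial σ k →ₐ[k] MvPolynomial τ k} (hφ : ∀ i, (φ (X i)).IsHomogeneous 1)
    (p : MvPolynomial σ k) (m : ℕ) :
    homogeneousComponent m (φ p) = φ (homogeneousComponent m p) := by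
  conv_lhs => rw [← sum_homogeneousComponent p]
  rw [map_sum, map_sum, Finset.sum_congr rfl fun i _ => homogeneousComponent_of_mem
    ((homogeneousComponent_isHomogeneous i p).map_algHom hφ), Finset.sum_ite_eq]
  split_ifs with h
  · rfl
  · rw [homogeneousComponent_eq_zero _ _ (by simpa using h), map_zero]

theorem Ideal.comap_span_singleton_apply {k R S : Type*} [Field k] [CommRing R] [CommRing S]
    [Algebra k R] [Algebra k S] (φ : R →ₐ[k] S)
    (hs : Function.Surjective φ) {A : Set R} (hA : RingHom.ker φ = Ideal.span A) (f : R) :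
    (Ideal.span {φ f}).comap φ = Ideal.span (A ∪ {f}) := by
  rw [← Set.image_singleton, ← Ideal.map_span, Ideal.comap_map_of_surjective' φ hs, hA, sup_comm,
    ← Ideal.span_union]

namespace ProjIdeal

open MvPolynomial

variable {k : Type*} [Field k] {n : ℕ}

theorem hilbertFunction_top (m : ℕ) :
    hilbertFunction (⊤ : Ideal (MvPolynomial (Fin (n + 1)) k)) m = 0 := by
  have : Subsingleton (MvPolynomial (Fin (n + 1)) k ⧸ (⊤ : Ideal (MvPolynomial (Fin (n + 1)) k))) :=
    Ideal.Quotient.subsingleton_iff.2 rfl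
  rw [hilbertFunction, Module.finrank_zero_of_subsingleton]

theorem hilbertFunction_zero_of_ne_top {I : Ideal (MvPolynomial (Fin (n + 1)) k)} (hI : I ≠ ⊤) :
    hilbertFunction I 0 = 1 := by
  have h := hilbertFunction_add_finrank_inf I 0
  have h0 : homogeneousSubmodule (Fin (n + 1)) k 0 ⊓ I.restrictScalars k = ⊥ := by
    rw [eq_bot_iff]
    rintro p ⟨hp, hpI⟩
    obtain ⟨a, rfl⟩ : ∃ a, p = C a :=
      ⟨_, totalDegree_eq_zero_iff_eq_C.1 ((totalDegree_zero_iff_isHomogeneous _).2 hp)⟩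
    by_contra hne
    have ha : a ≠ 0 := fun h => hne (by simp [h])
    exact hI (Ideal.eq_top_of_isUnit_mem _ hpI ((IsUnit.mk0 a ha).map C))
  rw [h0, finrank_bot] at h
  simpa using h

/-- Homogeneous ideals `I ≤ J` with the same Hilbert function are equal. -/
theorem eq_of_le_of_hilbertFunction_eq {I J : Ideal (MvPolynomial (Fin (n + 1)) k)} (hIJ : I ≤ J)
    (hJ : ∀ p ∈ J, ∀ m, homogeneousComponent m p ∈ J)
    (h : ∀ m, hilbertFunction I m = hilbertFunction J m) : I = J := by
  refine le_antisymm hIJ fun p hp => ?_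
  rw [← sum_homogeneousComponent p]
  refine sum_mem fun m _ => ?_
  have h1 := hilbertFunction_add_finrank_inf I m
  rw [← hilbertFunction_add_finrank_inf J m, h] at h1
  have h2 := Submodule.eq_of_le_of_finrank_eq (inf_le_inf_left _ hIJ) (Nat.add_left_cancel h1)
  have h3 : homogeneousComponent m p ∈
      (homogeneousSubmodule (Fin (n + 1)) k m ⊓ J.restrictScalars k : Submodule k _) :=
    ⟨homogeneousComponent_mem _ _, hJ p hp m⟩
  rw [← h2] at h3
  exact h3.2

/-- A homogeneous ideal with the Hilbert function of a hypersurface is principal. -/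
theorem exists_eq_span_singleton_of_hilbertFunction {r e : ℕ}
    {J : Ideal (MvPolynomial (Fin (r + 1)) k)}
    (hJ : ∀ p ∈ J, ∀ m, homogeneousComponent m p ∈ J)
    (h : ∀ m, hilbertFunction J m + (if e ≤ m then (m - e + r).choose r else 0) =
      (m + r).choose r) :
    ∃ g ≠ 0, J = Ideal.span {g} := by
  -- At `m = e` the subtracted binomial is `1`, so `J` contains a nonzero form of degree `e`.
  have h1 := h e
  rw [← hilbertFunction_add_finrank_inf J e, if_pos le_rfl] at h1
  have h2 : homogeneousSubmodule (Fin (r + 1)) k e ⊓ J.restrictScalars k ≠ ⊥ := fun h0 => by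
    rw [h0, finrank_bot] at h1
    simp at h1
  obtain ⟨g, ⟨hge, hgJ⟩, hg0⟩ := Submodule.exists_mem_ne_zero_of_ne_bot h2
  refine ⟨g, hg0, (eq_of_le_of_hilbertFunction_eq ?_ hJ fun m => ?_).symm⟩
  · rw [Ideal.span_le, Set.singleton_subset_iff]
    exact hgJ
  · exact Nat.add_right_cancel ((hilbertFunction_span_singleton hge hg0 m).trans (h m).symm)

theorem exists_linearForms_of_finrank_le {I : Ideal (MvPolynomial (Fin (n + 1)) k)} {c : ℕ}
    (h : hilbertFunction I 1 + c ≤ n + 1) :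
    ∃ u : Fin c → MvPolynomial (Fin (n + 1)) k, (∀ i, (u i).IsHomogeneous 1) ∧
      LinearIndependent k u ∧ ∀ i, u i ∈ I := by
  have h1 := hilbertFunction_add_finrank_inf I 1
  rw [add_comm 1 n, Nat.choose_succ_self_right] at h1
  obtain ⟨v, hv⟩ := exists_linearIndependent_of_le_finrank (R := k) (n := c)
    (M := (homogeneousSubmodule (Fin (n + 1)) k 1 ⊓ I.restrictScalars k : Submodule k _))
    (by omega)
  exact ⟨Subtype.val ∘ v, fun i => (v i).2.1,
    hv.map' (Submodule.subtype _) (Submodule.ker_subtype _), fun i => (v i).2.2⟩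

theorem exists_generators_of_hilbertFunction {I : Ideal (MvPolynomial (Fin (n + 1)) k)}
    (hI : I.IsHomogeneous (homogeneousSubmodule (Fin (n + 1)) k)) {c r : ℕ} (hc : n = c + r)
    (h : ∀ m, 1 ≤ m → hilbertFunction I m +
      (if degree I ≤ m then (m - degree I + r).choose r else 0) = (m + r).choose r) :
    ∃ (u : Fin c → MvPolynomial (Fin (n + 1)) k) (f : MvPolynomial (Fin (n + 1)) k),
      (∀ i, (u i).IsHomogeneous 1) ∧ LinearIndependent k u ∧ f ∉ Ideal.span (Set.range u) ∧
        I = Ideal.span (Set.range u ∪ {f}) := by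
  -- The hypothesis omits `m = 0`, but the formula persists there: either `I` is the unit ideal or
  -- both sides are governed by `hilbertFunction I 0 = 1`.
  have hall : ∀ m, hilbertFunction I m +
      (if degree I ≤ m then (m - degree I + r).choose r else 0) = (m + r).choose r := by
    intro m
    rcases Nat.eq_zero_or_pos m with rfl | hm
    · by_cases hD : degree I = 0
      · have h1 := h 1 le_rfl
        rw [hD, if_pos (by omega), Nat.sub_zero, Nat.add_eq_right] at h1
        rw [hD, eq_top_of_degree_eq_zero_of_hilbertFunction_one h1 hD, hilbertFunction_top]
        simp
      · rw [hilbertFunction_zero_of_ne_top fun hI => hD (by rw [hI, degree_top])]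
        simp [hD]
    · exact h m hm
  obtain ⟨u, hu, hli, huI⟩ := exists_linearForms_of_finrank_le (I := I) (c := c) (by
    have h1 := h 1 le_rfl
    rw [add_comm 1 r, Nat.choose_succ_self_right] at h1
    omega)
  obtain ⟨φ, ψ, hker, hφψ, hφ, hψ⟩ :=
    exists_algHom_ker_eq_span (show n + 1 = c + (r + 1) by omega) u hu hli
  have hs : Function.Surjective φ := fun p => ⟨ψ p, hφψ p⟩
  have hcomap : (I.map φ).comap φ = I := by
    rw [Ideal.comap_map_of_surjective' φ hs, sup_eq_left, hker, Ideal.span_le]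
    rintro _ ⟨i, rfl⟩
    exact huI i
  obtain ⟨g, hg0, hg⟩ := exists_eq_span_singleton_of_hilbertFunction (J := I.map φ)
    (e := degree I) (fun p hp m => by
      obtain ⟨q, hq, rfl⟩ := (Ideal.mem_map_iff_of_surjective φ hs).1 hp
      rw [homogeneousComponent_algHom hφ]
      exact Ideal.mem_map_of_mem φ (homogeneousComponent_mem_of_mem hI hq m)) fun m => by
    rw [← hilbertFunction_comap (map_homogeneousSubmodule_eq hφψ hφ hψ), hcomap, hall]
  refine ⟨u, ψ g, hu, hli, ?_, ?_⟩
  · rwa [← hker, RingHom.mem_ker, hφψ]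
  · rw [← Ideal.comap_span_singleton_apply φ hs hker]
    rw [hφψ, ← hg, hcomap]

theorem hilbertFunction_of_generators {I : Ideal (MvPolynomial (Fin (n + 1)) k)}
    (hI : I.IsHomogeneous (homogeneousSubmodule (Fin (n + 1)) k)) {c r : ℕ} (hc : n = c + r)
    (hdim : dimension I = (r : ℤ) - 1) {u : Fin c → MvPolynomial (Fin (n + 1)) k}
    {f : MvPolynomial (Fin (n + 1)) k} (hu : ∀ i, (u i).IsHomogeneous 1)
    (hli : LinearIndependent k u) (hf : f ∉ Ideal.span (Set.range u))
    (hIf : I = Ideal.span (Set.range u ∪ {f})) (m : ℕ) :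
    hilbertFunction I m + (if degree I ≤ m then (m - degree I + r).choose r else 0) =
      (m + r).choose r := by
  obtain ⟨φ, ψ, hker, hφψ, hφ, hψ⟩ :=
    exists_algHom_ker_eq_span (show n + 1 = c + (r + 1) by omega) u hu hli
  have hs : Function.Surjective φ := fun p => ⟨ψ p, hφψ p⟩
  have hcomap : I = (Ideal.span {φ f}).comap φ :=
    hIf.trans (Ideal.comap_span_singleton_apply φ hs hker f).symm
  have hg0 : φ f ≠ 0 := fun h => hf (hker ▸ h)
  have hfI : f ∈ I := hIf ▸ Ideal.subset_span (Or.inr rfl)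
  -- `f` itself may be inhomogeneous; its image generates a homogeneous ideal and is therefore a
  -- form.
  have hg := isHomogeneous_totalDegree_of_homogeneousComponent_mem (g := φ f) fun i => by
    rw [homogeneousComponent_algHom hφ, ← Ideal.mem_comap, ← hcomap]
    exact homogeneousComponent_mem_of_mem hI hfI i
  have hmap := map_homogeneousSubmodule_eq hφψ hφ hψ
  have hdeg : degree I = (φ f).totalDegree := by
    rw [hcomap] at hdim ⊢
    exact degree_comap_span_singleton hmap hs hg hg0 hdim
  rw [hdeg, hcomap, hilbertFunction_comap hmap, hilbertFunction_span_singleton hg hg0]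

end ProjIdeal

theorem proposition2p6 {k : Type*} [Field k] (n : ℕ)
    (I : Ideal (MvPolynomial (Fin (n + 1)) k))
    (hI : I.IsHomogeneous (MvPolynomial.homogeneousSubmodule (Fin (n + 1)) k))
    (d : ℤ) (hd : ProjIdeal.dimension I = d) (hdn : d ≤ (n : ℤ) - 1) :
    (∀ m : ℕ, 1 ≤ m →
        (ProjIdeal.hilbertFunction I m : ℤ) =
          ProjIdeal.binom ((m : ℤ) + d + 1) (d + 1)
            - ProjIdeal.binom ((m : ℤ) - (ProjIdeal.degree I : ℤ) + d + 1) (d + 1)) ↔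
      ∃ (u : Fin ((n : ℤ) - d - 1).toNat → MvPolynomial (Fin (n + 1)) k)
        (f : MvPolynomial (Fin (n + 1)) k),
        (∀ i, (u i).IsHomogeneous 1) ∧ LinearIndependent k u ∧
          f ∉ Ideal.span (Set.range u) ∧
          I = Ideal.span (Set.range u ∪ {f}) := by
  -- `dimension` is a natural number minus one, so `d ≥ -1`.
  obtain ⟨r, hr⟩ : ∃ r : ℕ, d = (r : ℤ) - 1 := ⟨_, hd.symm⟩
  obtain ⟨c, hc⟩ : ∃ c : ℕ, n = c + r := ⟨n - r, by omega⟩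
  have hcd : ((n : ℤ) - d - 1).toNat = c := by omega
  have hiff (m : ℕ) : (ProjIdeal.hilbertFunction I m : ℤ) =
      ProjIdeal.binom ((m : ℤ) + d + 1) (d + 1)
        - ProjIdeal.binom ((m : ℤ) - (ProjIdeal.degree I : ℤ) + d + 1) (d + 1) ↔
      ProjIdeal.hilbertFunction I m + (if ProjIdeal.degree I ≤ m then
        (m - ProjIdeal.degree I + r).choose r else 0) = (m + r).choose r := by
    rw [show (m : ℤ) + d + 1 = m + r by omega, show d + 1 = r by omega,
      show (m : ℤ) - ProjIdeal.degree I + d + 1 = m - ProjIdeal.degree I + r by omega,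
      ProjIdeal.binom_add_natCast, ProjIdeal.binom_sub_add_natCast]
    split_ifs <;> omega
  simp only [hiff]
  rw [hcd]
  constructor
  · exact ProjIdeal.exists_generators_of_hilbertFunction hI hc
  · rintro ⟨u, f, hu, hli, hf, hIf⟩ m -
    exact ProjIdeal.hilbertFunction_of_generators hI hc (hd.trans hr) hu hli hf hIf m
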